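/- Let $n\in\mathbb{N}$, let $X\subset\mathbb{R}^n$ be compact, and let $f:X\to\mathbb{R}$ be Lebesgue integrable and positive homogeneous, i.e. $f(\lambda x)=\lambda f(x)$ for every $\lambda>0$ and every $x\in X$ with $\lambda x\in X$. Let $|x|=\sum_{i=1}^n|x_i|$ denote the $\ell^1$ norm. Then for every $\varepsilon>0$ there is a feed-forward network $\mathcal{A}$ with input dimension $n$, one real output and finitely many layers, representing a function $$F_{\mathcal{A}}(x)=W^K\sigma\bigl(W^{K-1}\sigma(\cdots\sigma(W^1x+b^1)\cdots)+b^{K-1}\bigr)+b^K,$$ where $\sigma(t)=\max(t,0)$ is the (positive homogeneous) ReLU activation applied componentwise, and of width (the largest number of nodes in a layer) at most $n+4$, such that, with $G_{\mathcal{A}}(x)=|x|\,F_{\mathcal{A}}(x/|x|)$ for $x\neq 0$ and $G_{\mathcal{A}}(0)=0$, the function $G_{\mathcal{A}}-f$ is integrable on $X$ and $$\int_X\bigl|G_{\mathcal{A}}(x)-f(x)\bigr|\,dx<\varepsilon.$$ -/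

import Mathlib

namespace HomoApprox

/-- `f`, regarded as a function on `X`, is positive homogeneous: `f (c • x) = c * f x` for every
`c > 0`, whenever `x` and `c • x` both lie in `X`. Values of `f` outside `X` play no role. -/
def PosHomogeneousOn {E : Type*} [SMul ℝ E] (f : E → ℝ) (X : Set E) : Prop :=
  ∀ x ∈ X, ∀ c : ℝ, 0 < c → c • x ∈ X → f (c • x) = c * f x

/-- The rectified linear unit. -/
noncomputable def relu (t : ℝ) : ℝ := max t 0

/-- ReLU is a positive homogeneous activation function. -/
theorem relu_posHomogeneous : PosHomogeneousOn relu Set.univ := by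
  intro x _ c hc _
  simp [relu, mul_max_of_nonneg _ _ hc.le]

/-- Feed-forward networks (multilayer perceptrons) with `d` inputs and one real output: finitely
many hidden layers, each an affine map (weights `W`, bias `b`) followed by a componentwise
activation, and then an affine output layer. -/
inductive MLP : ℕ → Type
  | output {d : ℕ} (W : Matrix (Fin 1) (Fin d) ℝ) (b : Fin 1 → ℝ) : MLP d
  | hidden {d k : ℕ} (W : Matrix (Fin k) (Fin d) ℝ) (b : Fin k → ℝ) (next : MLP k) : MLP d

/-- The width: the largest number of nodes in a layer, over the input layer, all hidden layers and
the output layer. -/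
def MLP.width : {d : ℕ} → MLP d → ℕ
  | d, .output _ _ => max d 1
  | d, .hidden _ _ next => max d next.width

/-- The function represented by a network with activation function `σ`. -/
noncomputable def MLP.eval (σ : ℝ → ℝ) : {d : ℕ} → MLP d → (Fin d → ℝ) → ℝ
  | _, .output W b, x => (W.mulVec x + b) 0
  | _, .hidden W b next, x => next.eval σ fun i => σ ((W.mulVec x + b) i)

/-- The `ℓ¹` norm on `ℝⁿ`. -/
def l1norm {n : ℕ} (x : Fin n → ℝ) : ℝ := ∑ i, |x i|

/-- `x ↦ |x| F(x / |x|)` with `|·|` the `ℓ¹` norm and `F` the function represented by the network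
`A` with activation `σ`. The value at `x = 0` is `0`. -/
noncomputable def MLP.gEval (σ : ℝ → ℝ) {n : ℕ} (A : MLP n) (x : Fin n → ℝ) : ℝ :=
  l1norm x * A.eval σ ((l1norm x)⁻¹ • x)

end HomoApprox

namespace HomoApprox

open MeasureTheory Topology ENNReal

/-! On `X`, homogeneity gives `f x = |x| g (x/|x|)`. Let `ν` be the finite measure `|x| dx` on `X`
and `π x = x/|x|`. The error is then `∫ |F ∘ π - g ∘ π| dν`, the `L¹` distance of `F` and `g` under
the pushforward of `ν` by `π`, so homogeneity reduces the claim to ordinary `L¹` approximation for a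
finite measure carried by the cube. There `g` is `L¹`-close to a bounded continuous function, which
shallow ReLU networks approximate uniformly on the cube (`closure_span_ridge_eq_top`);
`exists_narrow_eq_shallowEval` trades their width for depth. The delicate point is measurability:
only `g ∘ π` is known to be a.e. measurable, and `aestronglyMeasurable_map_of_comp` transfers this
to `g`. -/

/-! ### Shallow ReLU networks -/

theorem continuous_dotProduct_coe {n : ℕ} (K : Set (Fin n → ℝ)) (w : Fin n → ℝ) :
    Continuous fun x : K => w ⬝ᵥ (x : Fin n → ℝ) :=
  continuous_finsetSum _ fun i _ =>
    continuous_const.mul ((continuous_apply i).comp continuous_subtype_val)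

/-- The ridge function `x ↦ relu (w ⬝ x + b)` on a set `K`. -/
noncomputable def ridge {n : ℕ} (K : Set (Fin n → ℝ)) (p : (Fin n → ℝ) × ℝ) : C(K, ℝ) where
  toFun x := relu (p.1 ⬝ᵥ (x : Fin n → ℝ) + p.2)
  continuous_toFun := ((continuous_dotProduct_coe K p.1).add continuous_const).max continuous_const

theorem ridge_apply {n : ℕ} (K : Set (Fin n → ℝ)) (p : (Fin n → ℝ) × ℝ) (x : K) :
    ridge K p x = relu (p.1 ⬝ᵥ (x : Fin n → ℝ) + p.2) := rfl

/-- The function computed by a shallow ReLU network, given as a list of neurons `(w, b, c)`. -/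
noncomputable def shallowEval {n : ℕ} (L : List (((Fin n → ℝ) × ℝ) × ℝ)) (x : Fin n → ℝ) : ℝ :=
  (L.map fun p => p.2 * relu (p.1.1 ⬝ᵥ x + p.1.2)).sum

theorem exists_shallowEval_of_mem_span_ridge {n : ℕ} {K : Set (Fin n → ℝ)} {g : C(K, ℝ)}
    (hg : g ∈ Submodule.span ℝ (Set.range (ridge K))) :
    ∃ L, ∀ x : K, g x = shallowEval L (x : Fin n → ℝ) := by
  induction hg using Submodule.span_induction with
  | mem g h =>
    obtain ⟨p, rfl⟩ := h
    exact ⟨[(p, 1)], fun x => by simp [shallowEval, ridge_apply]⟩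
  | zero => exact ⟨[], fun x => by simp [shallowEval]⟩
  | add g h _ _ hg hh =>
    obtain ⟨L, hL⟩ := hg
    obtain ⟨M, hM⟩ := hh
    exact ⟨L ++ M, fun x => by simp [shallowEval, hL, hM]⟩
  | smul a g _ hg =>
    obtain ⟨L, hL⟩ := hg
    refine ⟨L.map fun p => (p.1, a * p.2), fun x => ?_⟩
    simp [shallowEval, hL, List.map_map, Function.comp_def, mul_assoc, List.sum_map_mul_left]

/-! ### One-dimensional interpolation by ReLU -/

/-- The piecewise linear interpolation of `φ` at the nodes `a, a + δ, …, a + k * δ`, constant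
outside of `[a, a + k * δ]`. -/
noncomputable def reluInterp (φ : ℝ → ℝ) (a δ : ℝ) : ℕ → ℝ → ℝ
  | 0, _ => φ a
  | k + 1, t => reluInterp φ a δ k t + (φ (a + (k + 1 : ℕ) * δ) - φ (a + k * δ)) / δ *
      (relu (t - (a + k * δ)) - relu (t - (a + (k + 1 : ℕ) * δ)))

theorem reluInterp_of_le (φ : ℝ → ℝ) {a δ : ℝ} (hδ : 0 < δ) (k : ℕ) {t : ℝ}
    (ht : a + k * δ ≤ t) : reluInterp φ a δ k t = φ (a + k * δ) := by
  induction k with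
  | zero => simp [reluInterp]
  | succ k ih =>
    push_cast at ht ⊢
    rw [reluInterp, ih (by nlinarith), relu, relu, max_eq_left (by nlinarith),
      max_eq_left (by push_cast; linarith)]
    push_cast
    field_simp
    ring

/-- In the cell containing `t`, the interpolant and `φ t` each lie within `η` of the value of `φ` at
the left node. -/
theorem abs_reluInterp_sub_le (φ : ℝ → ℝ) {a δ η : ℝ} (hδ : 0 < δ) (k : ℕ)
    (h : ∀ s t, a ≤ s → s ≤ t → t ≤ a + k * δ → t - s ≤ δ → |φ t - φ s| ≤ η) {t : ℝ}
    (hat : a ≤ t) (ht : t ≤ a + k * δ) : |reluInterp φ a δ k t - φ t| ≤ 2 * η := by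
  induction k with
  | zero =>
    have : t = a := by simp at ht; linarith
    have := h a a le_rfl le_rfl (by simp) (by simpa using hδ.le)
    simp_all [reluInterp]
  | succ k ih =>
    push_cast at h ht
    have hk : 0 ≤ k * δ := by positivity
    rcases le_total t (a + k * δ) with h1 | h1
    · rw [reluInterp, relu, relu, max_eq_right (by linarith),
        max_eq_right (by push_cast; linarith)]
      simpa using ih (fun s u hs hsu hu => h s u hs hsu (by linarith)) h1
    · rw [reluInterp, reluInterp_of_le φ hδ k h1, relu, relu, max_eq_left (by linarith),
        max_eq_right (by push_cast; linarith)]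
      push_cast
      have e1 := h (a + k * δ) t (by linarith) h1 ht (by linarith)
      have e2 := h (a + k * δ) (a + (k + 1) * δ) (by linarith) (by linarith) le_rfl (by linarith)
      set u := t - (a + k * δ)
      have hu : |u / δ| ≤ 1 := by
        rw [abs_of_nonneg (div_nonneg (by simp [u]; linarith) hδ.le), div_le_one hδ]
        simp only [u]; linarith
      have e3 : |(φ (a + (k + 1) * δ) - φ (a + k * δ)) * (u / δ)| ≤ η * 1 := by
        rw [abs_mul]
        exact mul_le_mul e2 hu (abs_nonneg _) ((abs_nonneg _).trans e2)
      have e4 : φ (a + k * δ) + (φ (a + (k + 1) * δ) - φ (a + k * δ)) / δ * (u - 0) - φ t =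
        (φ (a + (k + 1) * δ) - φ (a + k * δ)) * (u / δ) - (φ t - φ (a + k * δ)) := by ring
      rw [e4]
      linarith [abs_sub ((φ (a + (k + 1) * δ) - φ (a + k * δ)) * (u / δ)) (φ t - φ (a + k * δ))]

theorem exists_reluInterp_approx {φ : ℝ → ℝ} (hφ : Continuous φ) (M : ℝ) {ε : ℝ} (hε : 0 < ε) :
    ∃ a δ k, ∀ t, |t| ≤ M → |reluInterp φ a δ k t - φ t| ≤ ε := by
  have hM : M ≤ |M| := le_abs_self M
  have hM0 := abs_nonneg M
  have huc := (isCompact_Icc (a := -|M|) (b := |M| + 1)).uniformContinuousOn_of_continuous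
    hφ.continuousOn
  obtain ⟨d, hd, h⟩ := Metric.uniformContinuousOn_iff.1 huc (ε / 2) (by positivity)
  -- The extra `1` keeps the cell width `b / k` positive when `M = 0`.
  set b := 2 * |M| + 1
  have hb : 0 < b := by positivity
  obtain ⟨k, hk⟩ := exists_nat_gt (b / d)
  have hk0 : (0 : ℝ) < k := (div_pos hb hd).trans hk
  have hkb : k * (b / k) = b := by field_simp
  refine ⟨-|M|, b / k, k, fun t ht => ?_⟩
  have ht' := abs_le.1 (ht.trans hM)
  have := abs_reluInterp_sub_le φ (η := ε / 2) (div_pos hb hk0) k (a := -|M|)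
    (fun s t hs hst htb hd' => ?_) ht'.1 (by rw [hkb]; simp only [b]; linarith)
  · linarith
  · rw [hkb] at htb
    simp only [b] at htb
    refine (h t ⟨by linarith, by linarith⟩ s ⟨hs, by linarith⟩ ?_).le
    rw [Real.dist_eq, abs_of_nonneg (by linarith)]
    refine hd'.trans_lt ?_
    rw [div_lt_iff₀ hk0]
    rwa [div_lt_iff₀ hd, mul_comm] at hk

theorem const_mem_span_ridge {n : ℕ} (K : Set (Fin n → ℝ)) (c : ℝ) :
    ContinuousMap.const K c ∈ Submodule.span ℝ (Set.range (ridge K)) := by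
  have : ContinuousMap.const K c = c • ridge K (0, 1) := by
    ext x; simp [ridge, relu]
  rw [this]
  exact Submodule.smul_mem _ _ (Submodule.subset_span ⟨_, rfl⟩)

theorem exists_mem_span_ridge_eq_reluInterp {n : ℕ} (K : Set (Fin n → ℝ)) (w : Fin n → ℝ)
    (φ : ℝ → ℝ) (a δ : ℝ) (k : ℕ) :
    ∃ g ∈ Submodule.span ℝ (Set.range (ridge K)),
      ∀ x : K, g x = reluInterp φ a δ k (w ⬝ᵥ (x : Fin n → ℝ)) := by
  induction k with
  | zero => exact ⟨_, const_mem_span_ridge K (φ a), fun x => by simp [reluInterp]⟩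
  | succ k ih =>
    obtain ⟨g, hg, h⟩ := ih
    refine ⟨g + ((φ (a + (k + 1 : ℕ) * δ) - φ (a + k * δ)) / δ) •
      (ridge K (w, -(a + k * δ)) - ridge K (w, -(a + (k + 1 : ℕ) * δ))),
      add_mem hg (Submodule.smul_mem _ _ (sub_mem (Submodule.subset_span ⟨_, rfl⟩)
        (Submodule.subset_span ⟨_, rfl⟩))), fun x => ?_⟩
    simp [reluInterp, h, ridge, sub_eq_add_neg]
    ring

/-! ### Density by Stone–Weierstrass -/

/-- The function `x ↦ exp (w ⬝ x)` on a set `K`. -/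
noncomputable def expRidge {n : ℕ} (K : Set (Fin n → ℝ)) (w : Fin n → ℝ) : C(K, ℝ) where
  toFun x := Real.exp (w ⬝ᵥ (x : Fin n → ℝ))
  continuous_toFun := Real.continuous_exp.comp (continuous_dotProduct_coe K w)

/-- By compactness `w ⬝ x` stays in a bounded interval, where `exp` is uniformly close to an
interpolant, itself a combination of ridges. -/
theorem expRidge_mem_closure_span_ridge {n : ℕ} (K : Set (Fin n → ℝ)) [CompactSpace K]
    (w : Fin n → ℝ) :
    expRidge K w ∈ (Submodule.span ℝ (Set.range (ridge K))).topologicalClosure := by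
  rw [← SetLike.mem_coe, Submodule.topologicalClosure_coe, Metric.mem_closure_iff]
  intro ε hε
  obtain ⟨M, hM⟩ := (isCompact_range (continuous_dotProduct_coe K w)).isBounded.exists_norm_le
  obtain ⟨a, δ, k, h⟩ := exists_reluInterp_approx Real.continuous_exp M (half_pos hε)
  obtain ⟨g, hg, hgx⟩ := exists_mem_span_ridge_eq_reluInterp K w Real.exp a δ k
  refine ⟨g, hg, lt_of_le_of_lt ?_ (half_lt_self hε)⟩
  rw [dist_comm, ContinuousMap.dist_le (half_pos hε).le]
  intro x
  rw [Real.dist_eq, hgx]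
  exact h _ (hM _ ⟨x, rfl⟩)

/-- The functions `x ↦ exp (w ⬝ x)` form a monoid under multiplication. -/
noncomputable def expRidgeSubmonoid {n : ℕ} (K : Set (Fin n → ℝ)) : Submonoid C(K, ℝ) where
  carrier := Set.range (expRidge K)
  mul_mem' := by
    rintro _ _ ⟨v, rfl⟩ ⟨w, rfl⟩
    exact ⟨v + w, by ext x; simp [expRidge, Real.exp_add]⟩
  one_mem' := ⟨0, by ext x; simp [expRidge]⟩

/-- Shallow ReLU networks are dense in the continuous functions on a compact set. -/
theorem closure_span_ridge_eq_top {n : ℕ} (K : Set (Fin n → ℝ)) [CompactSpace K] :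
    (Submodule.span ℝ (Set.range (ridge K))).topologicalClosure = ⊤ := by
  have hsep : (Algebra.adjoin ℝ (Set.range (expRidge K))).SeparatesPoints := by
    intro x y hxy
    obtain ⟨i, hi⟩ := Function.ne_iff.1 (Subtype.coe_injective.ne hxy)
    refine ⟨_, ⟨expRidge K (Pi.single i 1), Algebra.subset_adjoin ⟨_, rfl⟩, rfl⟩, ?_⟩
    simpa [expRidge] using hi
  have htop := ContinuousMap.subalgebra_topologicalClosure_eq_top_of_separatesPoints _ hsep
  have hle : (Algebra.adjoin ℝ (Set.range (expRidge K))).toSubmodule ≤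
      (Submodule.span ℝ (Set.range (ridge K))).topologicalClosure := by
    -- Products of exponentials are exponentials, so the generated algebra is merely their linear
    -- span.
    have : Submonoid.closure (Set.range (expRidge K)) = expRidgeSubmonoid K :=
      Submonoid.closure_eq (expRidgeSubmonoid K)
    rw [Algebra.adjoin_eq_span, this, Submodule.span_le]
    rintro _ ⟨w, rfl⟩
    exact expRidge_mem_closure_span_ridge K w
  refine eq_top_iff.2 fun g _ => ?_
  have hg : g ∈ (Algebra.adjoin ℝ (Set.range (expRidge K))).topologicalClosure := by
    rw [htop]; trivial
  exact closure_minimal hle (Submodule.isClosed_topologicalClosure _) hg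

theorem exists_shallowEval_approx {n : ℕ} {K : Set (Fin n → ℝ)} (hK : IsCompact K)
    {h : (Fin n → ℝ) → ℝ} (hh : ContinuousOn h K) {ε : ℝ} (hε : 0 < ε) :
    ∃ L, ∀ x ∈ K, |shallowEval L x - h x| ≤ ε := by
  have : CompactSpace K := isCompact_iff_compactSpace.1 hK
  let g : C(K, ℝ) := ⟨K.domRestrict h, hh.domRestrict⟩
  have hg : g ∈ closure (Submodule.span ℝ (Set.range (ridge K)) : Set C(K, ℝ)) := by
    rw [← Submodule.topologicalClosure_coe, closure_span_ridge_eq_top]; trivial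
  obtain ⟨r, hr, hgr⟩ := Metric.mem_closure_iff.1 hg ε hε
  obtain ⟨L, hL⟩ := exists_shallowEval_of_mem_span_ridge hr
  refine ⟨L, fun x hx => ?_⟩
  have := (ContinuousMap.dist_apply_le_dist (f := g) (g := r) ⟨x, hx⟩).trans hgr.le
  rw [dist_comm, Real.dist_eq, hL] at this
  exact this

/-! ### Trading width for depth -/

theorem relu_of_nonneg {t : ℝ} (ht : 0 ≤ t) : relu t = t := max_eq_left ht

theorem relu_nonneg (t : ℝ) : 0 ≤ relu t := le_max_right _ _

/-- A narrow network that evaluates a shallow one neuron by neuron: besides the input `y` it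
carries the value `z` of the last neuron, with pending coefficient `c`, and the positive part `p`
and negative part `m` of the sum accumulated so far. -/
theorem exists_narrow_tail {n : ℕ} (L : List (((Fin n → ℝ) × ℝ) × ℝ)) (c : ℝ) :
    ∃ N : MLP (n + 3), N.width ≤ n + 3 ∧ ∀ (y : Fin n → ℝ) (z p m : ℝ), (∀ i, 0 ≤ y i) →
      0 ≤ z → 0 ≤ p → 0 ≤ m →
      N.eval relu (Matrix.vecCons z (Matrix.vecCons p (Matrix.vecCons m y))) =
        p - m + c * z + shallowEval L y := by
  induction L generalizing c with
  | nil =>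
    refine ⟨.output (fun _ => Matrix.vecCons c (Matrix.vecCons 1 (Matrix.vecCons (-1) 0))) 0,
      by simp [MLP.width], fun y z p m _ _ _ _ => ?_⟩
    simp only [MLP.eval, Matrix.mulVec, Pi.add_apply, Matrix.cons_dotProduct_cons, shallowEval]
    simp
    ring
  | cons q L ih =>
    obtain ⟨⟨w, b⟩, c'⟩ := q
    obtain ⟨N, hN, h⟩ := ih c'
    -- The pending term `c * z` goes to `p` or `m` according to the sign of `c`, so every carried
    -- value stays nonnegative and passes ReLU unchanged.
    refine ⟨.hidden (k := n + 3)
      (Matrix.vecCons (Matrix.vecCons 0 (Matrix.vecCons 0 (Matrix.vecCons 0 w)))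
        (Matrix.vecCons (Matrix.vecCons (max c 0) (Matrix.vecCons 1 (Matrix.vecCons 0 0)))
          (Matrix.vecCons (Matrix.vecCons (max (-c) 0) (Matrix.vecCons 0 (Matrix.vecCons 1 0)))
            fun i => Matrix.vecCons 0 (Matrix.vecCons 0 (Matrix.vecCons 0 (Pi.single i 1))))))
      (Matrix.vecCons b 0) N, by simp [MLP.width, hN], fun y z p m hy hz hp hm => ?_⟩
    have e1 : 0 ≤ max c 0 * z := mul_nonneg (le_max_right _ _) hz
    have e2 : 0 ≤ max (-c) 0 * z := mul_nonneg (le_max_right _ _) hz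
    have e3 : max c 0 - max (-c) 0 = c := by
      rcases le_total c 0 with h | h <;> simp [h]
    have key := h y (relu (w ⬝ᵥ y + b)) (max c 0 * z + p) (max (-c) 0 * z + m) hy
      (relu_nonneg _) (by positivity) (by positivity)
    have e4 : max c 0 * z + p - (max (-c) 0 * z + m) + c' * relu (w ⬝ᵥ y + b) + shallowEval L y =
        p - m + c * z + shallowEval (((w, b), c') :: L) y := by
      simp only [shallowEval, List.map_cons, List.sum_cons]
      linear_combination z * e3
    simp only [MLP.eval]
    rw [← e4, ← key]
    congr 1
    funext i
    refine Fin.cases ?_ (fun i => Fin.cases ?_ (fun i => Fin.cases ?_ (fun i => ?_) i) i) i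
    · simp [Matrix.mulVec]
    · simpa [Matrix.mulVec] using relu_of_nonneg (by positivity)
    · simpa [Matrix.mulVec] using relu_of_nonneg (by positivity)
    · simpa [Matrix.mulVec] using relu_of_nonneg (hy i)

/-- On the cube `[-1, 1]ⁿ` every shallow ReLU network agrees with one of width at most `n + 3`. -/
theorem exists_narrow_eq_shallowEval {n : ℕ} (L : List (((Fin n → ℝ) × ℝ) × ℝ)) :
    ∃ A : MLP n, A.width ≤ n + 3 ∧
      ∀ x : Fin n → ℝ, (∀ i, |x i| ≤ 1) → A.eval relu x = shallowEval L x := by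
  -- The tail needs nonnegative inputs, so it is fed `x + 1`; the shifted biases undo the
  -- translation.
  obtain ⟨N, hN, h⟩ := exists_narrow_tail
    (L.map fun p => ((p.1.1, p.1.2 - p.1.1 ⬝ᵥ (1 : Fin n → ℝ)), p.2)) 0
  refine ⟨.hidden (k := n + 3)
    (Matrix.vecCons 0 (Matrix.vecCons 0 (Matrix.vecCons 0 fun i => Pi.single i 1)))
    (Matrix.vecCons 0 (Matrix.vecCons 0 (Matrix.vecCons 0 1))) N,
    max_le (by omega) hN, fun x hx => ?_⟩
  have hx0 : ∀ i, 0 ≤ (x + 1) i := fun i => by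
    have := (abs_le.1 (hx i)).1
    simp only [Pi.add_apply, Pi.one_apply]
    linarith
  have key := h (x + 1) 0 0 0 hx0 le_rfl le_rfl le_rfl
  have e : shallowEval (L.map fun p => ((p.1.1, p.1.2 - p.1.1 ⬝ᵥ (1 : Fin n → ℝ)), p.2)) (x + 1) =
      shallowEval L x := by
    simp [shallowEval, Function.comp_def, dotProduct_add]
  rw [e] at key
  simp only [MLP.eval]
  rw [show shallowEval L x = 0 - 0 + 0 * 0 + shallowEval L x by ring, ← key]
  congr 1
  funext i
  refine Fin.cases ?_ (fun i => Fin.cases ?_ (fun i => Fin.cases ?_ (fun i => ?_) i) i) i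
  · simp [Matrix.mulVec, relu]
  · simp [Matrix.mulVec, relu]
  · simp [Matrix.mulVec, relu]
  · simpa [Matrix.mulVec] using relu_of_nonneg (hx0 i)

/-! ### Descent of measurability -/

/-- Up to a null set, a null-measurable preimage `π ⁻¹' A` is the preimage of a measurable subset
of `A`. -/
theorem exists_measurableSet_subset_preimage_sdiff_null {α β : Type*} [TopologicalSpace α]
    [T2Space α] [MeasurableSpace α] [OpensMeasurableSpace α] [TopologicalSpace β] [T2Space β]
    [MeasurableSpace β] [OpensMeasurableSpace β] {ν : Measure α} [IsFiniteMeasure ν]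
    [ν.InnerRegularCompactLTTop] {π : α → β} {s : Set α}
    (hs : MeasurableSet s) (hπs : ContinuousOn π s) (hν : ν sᶜ = 0) {A : Set β}
    (hA : NullMeasurableSet (π ⁻¹' A) ν) :
    ∃ S ⊆ A, MeasurableSet S ∧ ν (π ⁻¹' A \ π ⁻¹' S) = 0 := by
  obtain ⟨M, hMA, hM, hMae⟩ := hA.exists_measurable_subset_ae_eq
  -- Images of measurable sets need not be measurable, but images of compact sets are compact, hence
  -- closed; inner regularity makes the loss null.
  choose K hK hKc hKν using fun k : ℕ => (hM.inter hs).exists_isCompact_sdiff_lt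
    (measure_ne_top ν _) (ε := (k + 1 : ℝ≥0∞)⁻¹) (by simp)
  refine ⟨⋃ k, π '' K k, Set.iUnion_subset fun k => ?_, .iUnion fun k => ?_, ?_⟩
  · rintro _ ⟨x, hx, rfl⟩
    exact hMA (hK k hx).1
  · exact ((hKc k).image_of_continuousOn
      (hπs.mono fun x hx => (hK k hx).2)).isClosed.measurableSet
  · have h0 : ν ((M ∩ s) \ ⋃ k, K k) = 0 := by
      refine le_antisymm (ge_of_tendsto'
        ((Filter.tendsto_add_atTop_iff_nat 1).2 ENNReal.tendsto_inv_nat_nhds_zero)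
        fun k => ?_) zero_le
      refine (measure_mono ?_).trans ((hKν k).le.trans (by simp))
      exact Set.sdiff_subset_sdiff_right (Set.subset_iUnion K k)
    have h1 : ν (π ⁻¹' A \ M) = 0 := ae_le_set.1 hMae.symm.le
    refine measure_mono_null (t := (π ⁻¹' A \ M) ∪ sᶜ ∪ ((M ∩ s) \ ⋃ k, K k)) ?_
      (measure_union_null (measure_union_null h1 hν) h0)
    rintro x ⟨hxA, hxS⟩
    by_cases hxM : x ∈ M
    · by_cases hxs : x ∈ s
      · refine .inr ⟨⟨hxM, hxs⟩, fun hx => hxS ?_⟩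
        obtain ⟨k, hk⟩ := Set.mem_iUnion.1 hx
        exact Set.mem_iUnion.2 ⟨k, x, hk, rfl⟩
      · exact .inl (.inr hxs)
    · exact .inl (.inl ⟨hxA, hxM⟩)

/-- Almost everywhere measurability descends along a map which is continuous almost everywhere. -/
theorem aestronglyMeasurable_map_of_comp {α β : Type*} [TopologicalSpace α]
    [T2Space α] [MeasurableSpace α] [OpensMeasurableSpace α] [TopologicalSpace β] [T2Space β]
    [MeasurableSpace β] [OpensMeasurableSpace β] {ν : Measure α} [IsFiniteMeasure ν]
    [ν.InnerRegularCompactLTTop] {π : α → β} (hπ : Measurable π) {s : Set α}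
    (hs : MeasurableSet s) (hπs : ContinuousOn π s) (hν : ν sᶜ = 0) {g : β → ℝ}
    (hg : AEMeasurable (g ∘ π) ν) : AEStronglyMeasurable g (ν.map π) := by
  refine aestronglyMeasurable_iff_nullMeasurable_separable.2
    ⟨fun B hB => ?_, Set.univ, TopologicalSpace.IsSeparable.of_separableSpace _, by simp⟩
  -- Applied to `B` and to `Bᶜ`, this traps `g ⁻¹' B` between the measurable sets `S` and `Tᶜ`,
  -- which differ by a null set.
  obtain ⟨S, hSA, hS, hS0⟩ := exists_measurableSet_subset_preimage_sdiff_null hs hπs hν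
    (A := g ⁻¹' B) (hg.nullMeasurable hB)
  obtain ⟨T, hTA, hT, hT0⟩ := exists_measurableSet_subset_preimage_sdiff_null hs hπs hν
    (A := g ⁻¹' Bᶜ) (hg.nullMeasurable hB.compl)
  refine hS.nullMeasurableSet.congr (ae_eq_set.2 ⟨?_, ?_⟩)
  · rw [Set.sdiff_eq_empty.2 hSA, measure_empty]
  · have hsub : g ⁻¹' B \ S ⊆ Tᶜ \ S :=
      Set.sdiff_subset_sdiff_left fun x hx hxT => hTA hxT hx
    refine measure_mono_null hsub ?_
    rw [Measure.map_apply hπ (hT.compl.diff hS)]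
    refine measure_mono_null ?_ (measure_union_null hS0 hT0)
    rintro x ⟨hxT, hxS⟩
    by_cases hx : g (π x) ∈ B
    · exact .inl ⟨hx, hxS⟩
    · exact .inr ⟨hx, hxT⟩

/-! ### The radial projection -/

theorem l1norm_nonneg {n : ℕ} (x : Fin n → ℝ) : 0 ≤ l1norm x :=
  Finset.sum_nonneg fun _ _ => abs_nonneg _

theorem l1norm_eq_zero_iff {n : ℕ} {x : Fin n → ℝ} : l1norm x = 0 ↔ x = 0 := by
  rw [l1norm, Finset.sum_eq_zero_iff_of_nonneg fun _ _ => abs_nonneg _]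
  simp [funext_iff]

theorem continuous_l1norm {n : ℕ} : Continuous (l1norm : (Fin n → ℝ) → ℝ) := by
  unfold l1norm
  fun_prop

theorem abs_inv_l1norm_smul_apply_le {n : ℕ} (x : Fin n → ℝ) (i : Fin n) :
    |((l1norm x)⁻¹ • x) i| ≤ 1 := by
  rw [Pi.smul_apply, smul_eq_mul, abs_mul, abs_inv, abs_of_nonneg (l1norm_nonneg x), mul_comm,
    ← div_eq_mul_inv]
  exact div_le_one_of_le₀ (Finset.single_le_sum (f := fun i => |x i|)
    (fun _ _ => abs_nonneg _) (Finset.mem_univ i)) (l1norm_nonneg x)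

theorem continuous_shallowEval {n : ℕ} (L : List (((Fin n → ℝ) × ℝ) × ℝ)) :
    Continuous (shallowEval L) := by
  induction L with
  | nil => exact continuous_const
  | cons p L ih =>
    have hr : Continuous relu := continuous_id.max continuous_const
    have hd : Continuous fun x : Fin n → ℝ => p.1.1 ⬝ᵥ x := by
      unfold dotProduct
      fun_prop
    exact (continuous_const.mul (hr.comp (hd.add continuous_const))).add ih

/-- Continuous functions on the cube `[-1, 1]ⁿ` are uniformly approximated by ReLU networks of
width at most `n + 3`. -/
theorem exists_narrow_approx {n : ℕ} {h : (Fin n → ℝ) → ℝ} (hh : Continuous h) {ε : ℝ}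
    (hε : 0 < ε) :
    ∃ A : MLP n, A.width ≤ n + 3 ∧ ∃ S : (Fin n → ℝ) → ℝ, Continuous S ∧
      ∀ x : Fin n → ℝ, (∀ i, |x i| ≤ 1) → A.eval relu x = S x ∧ |S x - h x| ≤ ε := by
  obtain ⟨L, hL⟩ := exists_shallowEval_approx
    (isCompact_univ_pi fun _ : Fin n => isCompact_Icc (a := (-1 : ℝ)) (b := 1)) hh.continuousOn hε
  obtain ⟨A, hA, hAL⟩ := exists_narrow_eq_shallowEval L
  exact ⟨A, hA, _, continuous_shallowEval L,
    fun x hx => ⟨hAL x hx, hL x fun i _ => abs_le.1 (hx i)⟩⟩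

/-- A positive homogeneous function on `X` factors through the radial projection. -/
theorem PosHomogeneousOn.exists_eq_l1norm_mul {n : ℕ} {X : Set (Fin n → ℝ)}
    {f : (Fin n → ℝ) → ℝ} (hom : PosHomogeneousOn f X) :
    ∃ g : (Fin n → ℝ) → ℝ, ∀ x ∈ X, l1norm x * g ((l1norm x)⁻¹ • x) = f x := by
  classical
  refine ⟨fun y => if h : ∃ t : ℝ, 0 < t ∧ t • y ∈ X then f (h.choose • y) / h.choose else 0,
    fun x hx => ?_⟩
  rcases eq_or_ne x 0 with rfl | hx0
  -- Homogeneity at the origin forces `f 0 = 2 * f 0`, so `f 0 = 0`.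
  · have := hom 0 hx 2 two_pos (by simpa using hx)
    rw [smul_zero] at this
    have h0 : l1norm (0 : Fin n → ℝ) = 0 := l1norm_eq_zero_iff.2 rfl
    rw [h0, zero_mul]
    linarith
  · have hpos : 0 < l1norm x := (l1norm_nonneg x).lt_of_ne' (l1norm_eq_zero_iff.not.2 hx0)
    have h : ∃ t : ℝ, 0 < t ∧ t • (l1norm x)⁻¹ • x ∈ X :=
      ⟨l1norm x, hpos, by rwa [smul_inv_smul₀ hpos.ne']⟩
    obtain ⟨ht, htX⟩ := h.choose_spec
    simp only [dif_pos h]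
    rw [smul_smul] at htX ⊢
    rw [hom x hx _ (by positivity) htX, mul_assoc, mul_div_cancel_left₀ _ ht.ne',
      mul_inv_cancel_left₀ hpos.ne']

end HomoApprox

/-! ### The main theorem -/

open MeasureTheory HomoApprox in
theorem mainTheorem5 (n : ℕ) (X : Set (Fin n → ℝ)) (hX : IsCompact X)
    (f : (Fin n → ℝ) → ℝ) (hom : HomoApprox.PosHomogeneousOn f X)
    (hf : MeasureTheory.IntegrableOn f X MeasureTheory.volume)
    (ε : ℝ) (hε : 0 < ε) :
    ∃ A : HomoApprox.MLP n, A.width ≤ n + 4 ∧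
      MeasureTheory.IntegrableOn (fun x => |A.gEval HomoApprox.relu x - f x|) X
        MeasureTheory.volume ∧
      ∫ x in X, |A.gEval HomoApprox.relu x - f x| < ε := by
  obtain ⟨g, hg⟩ := hom.exists_eq_l1norm_mul
  let π : (Fin n → ℝ) → (Fin n → ℝ) := fun x => (l1norm x)⁻¹ • x
  let d : (Fin n → ℝ) → NNReal := fun x => (l1norm x).toNNReal
  have hd : Measurable d := (continuous_real_toNNReal.comp continuous_l1norm).measurable
  have hds : ∀ x (r : ℝ), d x • r = l1norm x * r := fun x r => by
    rw [NNReal.smul_def, Real.coe_toNNReal _ (l1norm_nonneg x), smul_eq_mul]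
  have hπ : Measurable π :=
    (continuous_l1norm.measurable.inv).smul measurable_id
  have hπc : ContinuousOn π {0}ᶜ := fun x hx => ((continuous_l1norm.continuousAt.inv₀
    (l1norm_eq_zero_iff.not.2 hx)).smul continuousAt_id).continuousWithinAt
  let ν : Measure (Fin n → ℝ) := (volume.restrict X).withDensity fun x => (d x : ENNReal)
  have hfin : IsFiniteMeasure ν := isFiniteMeasure_withDensity_ofReal
    (continuous_l1norm.continuousOn.integrableOn_compact hX).2
  -- The weight vanishes at the origin, the only point where `π` may be discontinuous.
  have hν0 : ν ({0}ᶜᶜ) = 0 := by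
    rw [compl_compl, withDensity_apply _ (measurableSet_singleton 0)]
    refine (setLIntegral_congr_fun (g := 0) (measurableSet_singleton 0) fun x hx => ?_).trans
      (by simp)
    have hx0 : x = 0 := hx
    simp [d, l1norm_eq_zero_iff.2 hx0]
  have hgν : Integrable (g ∘ π) ν := by
    rw [integrable_withDensity_iff_integrable_smul hd]
    exact (integrableOn_congr_fun (fun x hx => by rw [hds]; exact hg x hx)
      hX.measurableSet).2 hf
  have hgm : AEStronglyMeasurable g (ν.map π) := aestronglyMeasurable_map_of_comp hπ
    (measurableSet_singleton 0).compl hπc hν0 hgν.aemeasurable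
  have hgi : Integrable g (ν.map π) := (integrable_map_measure hgm hπ.aemeasurable).2 hgν
  obtain ⟨h, hgh, hhi⟩ := hgi.exists_boundedContinuous_integral_sub_le (half_pos hε)
  rw [integral_map (f := fun x => ‖g x - h x‖) hπ.aemeasurable (hgm.sub hhi.1).norm] at hgh
  have hhν : Integrable (h ∘ π) ν := (integrable_map_measure hhi.1 hπ.aemeasurable).1 hhi
  set m := ν.real Set.univ
  have hm : 0 ≤ m := measureReal_nonneg
  -- A uniform error `ε / (2 * (m + 1))` costs less than `ε / 2` against mass `m`; the `+ 1` covers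
  -- `m = 0`. The continuous `S` stands in for the network to supply measurability.
  obtain ⟨A, hA, S, hS, hAS⟩ := exists_narrow_approx h.continuous
    (show 0 < ε / (2 * (m + 1)) by positivity)
  replace hAS := fun x => hAS (π x) (abs_inv_l1norm_smul_apply_le x)
  have hSh : Integrable (fun x => S (π x) - h (π x)) ν := Integrable.of_bound
    ((hS.measurable.comp hπ).aestronglyMeasurable.sub hhν.1) _ (.of_forall fun x => (hAS x).2)
  have hghν : Integrable (fun x => ‖g (π x) - h (π x)‖) ν := (hgν.sub hhν).norm
  have hSg : Integrable (fun x => |S (π x) - g (π x)|) ν := by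
    refine ((hSh.add hhν).sub hgν).abs.congr (.of_forall fun x => ?_)
    simp
  have heq : Set.EqOn (fun x => d x • |S (π x) - g (π x)|) (fun x => |A.gEval relu x - f x|) X := by
    intro x hx
    simp only [hds]
    rw [MLP.gEval, ← hg x hx, ← mul_sub, abs_mul, abs_of_nonneg (l1norm_nonneg x), ← (hAS x).1]
  refine ⟨A, hA.trans (by omega), ?_, ?_⟩
  · exact (integrableOn_congr_fun heq hX.measurableSet).1
      ((integrable_withDensity_iff_integrable_smul hd).1 hSg)
  · calc ∫ x in X, |A.gEval relu x - f x| = ∫ x in X, d x • |S (π x) - g (π x)| :=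
          (setIntegral_congr_fun hX.measurableSet heq).symm
      _ = ∫ x, |S (π x) - g (π x)| ∂ν := (integral_withDensity_eq_integral_smul hd _).symm
      _ ≤ ∫ x, (ε / (2 * (m + 1)) + ‖g (π x) - h (π x)‖) ∂ν := by
          refine integral_mono hSg ((integrable_const _).add hghν) fun x => ?_
          have h1 := (hAS x).2
          have h2 := abs_sub_le (S (π x)) (h (π x)) (g (π x))
          rw [abs_sub_comm (h (π x))] at h2
          simp only [Real.norm_eq_abs]
          linarith
      _ = m * (ε / (2 * (m + 1))) + ∫ x, ‖g (π x) - h (π x)‖ ∂ν := by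
          rw [integral_add (integrable_const _) hghν, integral_const, smul_eq_mul]
      _ < ε := by
          have : m * (ε / (2 * (m + 1))) < ε / 2 := by
            rw [mul_div_assoc', div_lt_div_iff₀ (by positivity) two_pos]
            nlinarith
          linarith
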